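/- Let $\mathbb N=\{1,2,3,\dots\}$. For a set $X$ let $\mathcal P_f(X)$ be the set of nonempty finite subsets of $X$, and let ${}^{\mathbb N}\mathbb N$ be the set of all functions $\mathbb N\to\mathbb N$. For nonempty finite sets $\beta,\gamma$ of positive integers write $\beta<\gamma$ if $\max\beta<\min\gamma$. Let $\beta\mathbb N$ be the set of ultrafilters on $\mathbb N$, with the addition given by $A\in p+q$ if and only if $\{x\in\mathbb N:\{y\in\mathbb N: x+y\in A\}\in q\}\in p$. A set $A\subseteq\mathbb N$ is a $J$-set if for every $F\in\mathcal P_f({}^{\mathbb N}\mathbb N)$ there are $a\in\mathbb N$ and $\beta\in\mathcal P_f(\mathbb N)$ such that $a+\sum_{t\in\beta}f(t)\in A$ for all $f\in F$; and $\mathcal J=\{p\in\beta\mathbb N:\text{every }A\in p\text{ is a }J\text{-set}\}$. For $p_1,p_2,\dots\in\beta\mathbb N$ the ultrafilter $\bigotimes_{i=1}^{k}p_i$ on $\mathbb N^k$ is defined by $\bigotimes_{i=1}^1p_i=p_1$ and, for $A\subseteq\mathbb N^{k+1}$, $A\in\bigotimes_{i=1}^{k+1}p_i$ if and only if $$\bigl\{(x_1,\dots,x_k)\in\mathbb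 N^k:\{x_{k+1}\in\mathbb N:(x_1,\dots,x_{k+1})\in A\}\in p_{k+1}\bigr\}\in\bigotimes_{i=1}^{k}p_i .$$ **Theorem (Multidimensional Stronger Central Sets Theorem II).** Let $m\in\mathbb N$ and $A\subseteq\mathbb N^m$. The following two statements are equivalent. (1) There exist functions $\alpha_1,\dots,\alpha_m:\mathcal P_f({}^{\mathbb N}\mathbb N)\to\mathbb N$ and $H_1,\dots,H_m:\mathcal P_f({}^{\mathbb N}\mathbb N)\to\mathcal P_f(\mathbb N)$ such that (a) if $F,G\in\mathcal P_f({}^{\mathbb N}\mathbb N)$ and $F\subsetneq G$, then $\max H_j(F)<\min H_j(G)$ for every $j\in\{1,\dots,m\}$; and (b) whenever $n\ge m$ is an integer, $G_1\subsetneq G_2\subsetneq\dots\subsetneq G_n$ are in $\mathcal P_f({}^{\mathbb N}\mathbb N)$, $\beta_1<\beta_2<\dots<\beta_m$ are nonempty subsets of $\{1,\dots,n\}$, and $f_i\in G_i$ for every $i\in\{1,\dots,n\}$, one has $$\left(\sum_{i\in\beta_1}\Bigl(\alpha_1(G_i)+\sum_{t\in H_1(G_i)}f_i(t)\Bigr),\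 \dots,\ \sum_{i\in\beta_m}\Bigl(\alpha_m(G_i)+\sum_{t\in H_m(G_i)}f_i(t)\Bigr)\right)\in A .$$ (2) There exist $p_1,\dots,p_m\in\mathcal J$ with $p_j+p_j=p_j$ for every $j\in\{1,\dots,m\}$, such that $A\in\bigotimes_{i=1}^m p_i$. -/

import Mathlib

-- Mathlib's addition of ultrafilters: `A ∈ p + q ↔ {x | {y | x + y ∈ A} ∈ q} ∈ p`.
attribute [local instance] Ultrafilter.add

namespace CentralSets

/-- `𝒫_f(X)`: the nonempty finite subsets of `X`. -/
abbrev Pf (X : Type*) : Type _ := {s : Finset X // s.Nonempty}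

/-- The sum `∑ i ∈ s, g i` of positive integers over a nonempty finite set,
as a positive integer. -/
def pfSum {ι : Type*} (s : Pf ι) (g : ι → ℕ+) : ℕ+ :=
  ⟨∑ i ∈ s.1, (g i : ℕ), Finset.sum_pos (fun i _ => (g i).pos) s.2⟩

theorem coe_pfSum {ι : Type*} (s : Pf ι) (g : ι → ℕ+) :
    ((pfSum s g : ℕ+) : ℕ) = ∑ i ∈ s.1, (g i : ℕ) := rfl

/-- `s < t` for nonempty finite sets of a linear order: `max s < min t`. -/
def Before {ι : Type*} [LinearOrder ι] (s t : Pf ι) : Prop :=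
  s.1.max' s.2 < t.1.min' t.2

/-- `J`-sets of positive integers. -/
def IsJSet (A : Set ℕ+) : Prop :=
  ∀ F : Pf (ℕ+ → ℕ+), ∃ (a : ℕ+) (b : Pf ℕ+), ∀ f ∈ F.1, a + pfSum b f ∈ A

/-- The set `𝒥 ⊆ βℕ` of ultrafilters all of whose members are `J`-sets. -/
def J : Set (Ultrafilter ℕ+) := {p | ∀ A ∈ p, IsJSet A}

theorem mem_ultrafilter_add (p q : Ultrafilter ℕ+) (A : Set ℕ+) :
    A ∈ p + q ↔ {x : ℕ+ | {y : ℕ+ | x + y ∈ A} ∈ q} ∈ p := Iff.rfl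

/-- The tensor product `p₁ ⊗ ⋯ ⊗ p_k`, an ultrafilter on `X ^ k`, by recursion on `k`;
`mem_tensor_one` and `mem_tensor_succ` below are the usual recursive description. -/
def tensor {X : Type*} : (k : ℕ) → (Fin k → Ultrafilter X) → Ultrafilter (Fin k → X)
  | 0, _ => pure Fin.elim0
  | k + 1, p =>
      (tensor k (Fin.init p)).bind fun x =>
        (p (Fin.last k)).map fun y => (Fin.snoc x y : Fin (k + 1) → X)

theorem mem_tensor_succ {X : Type*} (k : ℕ) (p : Fin (k + 1) → Ultrafilter X)
    (A : Set (Fin (k + 1) → X)) :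
    A ∈ tensor (k + 1) p ↔
      {x : Fin k → X | {y : X | (Fin.snoc x y : Fin (k + 1) → X) ∈ A} ∈ p (Fin.last k)} ∈
        tensor k (Fin.init p) := Iff.rfl

theorem mem_tensor_one {X : Type*} (p : Fin 1 → Ultrafilter X) (A : Set (Fin 1 → X)) :
    A ∈ tensor 1 p ↔ {y : X | (fun _ => y) ∈ A} ∈ p 0 := by
  have h : ∀ y : X, (Fin.snoc (Fin.elim0 : Fin 0 → X) y : Fin 1 → X) = fun _ => y := by
    intro y
    funext i
    fin_cases i
    rfl
  rw [mem_tensor_succ]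
  change _ ∈ (pure Fin.elim0 : Ultrafilter (Fin 0 → X)) ↔ _
  rw [Ultrafilter.mem_pure]
  simp only [Set.mem_ofPred_eq, h]
  rfl

end CentralSets

open CentralSets

/-!
By the Hales–Jewett theorem `J`-sets are partition regular, so every `J`-set belongs to an
ultrafilter in `𝒥`. Given `α_j` and `H_j`, the sums of the values `α_j(G) + ∑ t ∈ H_j(G), f(t)`
along the chains above a fixed `G` form a `J`-set, which decreases with `G` and absorbs the addition
of sums along chains high enough. Hence the ultrafilters in `𝒥` containing all these sets form a
nonempty compact semigroup, and `p_j` is one of its idempotents.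

Conversely, `α_m` and `H_m` are built by recursion on `G` so that every sum along a chain starting
at `G` lies in a prescribed member `B G` of `p_m`; idempotency keeps each partial sum extendable.
Below `G` there are only finitely many tuples of sums for the first `m - 1` coordinates, so `B G`
can be the finite intersection of the sections of `A` at these tuples. The first `m - 1`
coordinates come from induction on `m`.
-/

namespace CentralSets

open Filter Function

section JSets

theorem IsJSet.mono {A B : Set ℕ+} (hA : IsJSet A) (h : A ⊆ B) : IsJSet B := fun F => by
  obtain ⟨a, b, hab⟩ := hA F
  exact ⟨a, b, fun f hf => h (hab f hf)⟩

theorem not_isJSet_empty : ¬ IsJSet ∅ := fun h => by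
  obtain ⟨_, _, hab⟩ := h ⟨{fun _ => 1}, Finset.singleton_nonempty _⟩
  exact hab _ (Finset.mem_singleton_self _)

theorem IsJSet.exists_forall_lt {A : Set ℕ+} (hA : IsJSet A) (r : ℕ+) (F : Pf (ℕ+ → ℕ+)) :
    ∃ (a : ℕ+) (b : Pf ℕ+), (∀ t ∈ b.1, r < t) ∧ ∀ f ∈ F.1, a + pfSum b f ∈ A := by
  classical
  obtain ⟨a, b, hab⟩ := hA ⟨F.1.image fun f t => f (r + t), F.2.image _⟩
  refine ⟨a, ⟨b.1.map (addLeftEmbedding r), b.2.map⟩, ?_, fun f hf => ?_⟩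
  · simpa using fun t _ => PNat.lt_add_right r t
  · have hshift : pfSum ⟨b.1.map (addLeftEmbedding r), b.2.map⟩ f = pfSum b fun t => f (r + t) :=
      PNat.coe_injective (by simp [coe_pfSum])
    rw [hshift]
    exact hab _ (Finset.mem_image_of_mem _ hf)

/-- The sequence whose `t`-th term collects one value of each of the sequences `w i`, namely the
value at `e (t, i)`; it turns words over an alphabet of sequences into sequences. -/
def interleave {ι : Type*} [Fintype ι] [Nonempty ι] (e : ℕ+ × ι → ℕ+) (w : ι → ℕ+ → ℕ+) :
    ℕ+ → ℕ+ :=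
  fun t => pfSum ⟨Finset.univ, Finset.univ_nonempty⟩ fun i => w i (e (t, i))

/-- The constant coordinates of the line are absorbed into `a'`, and its active coordinates
into `b'`. -/
theorem exists_add_pfSum_eq_interleave_line {ι κ : Type*} [Fintype ι] [Nonempty ι]
    {e : ℕ+ × ι → ℕ+} (he : Injective e) (v : κ → ℕ+ → ℕ+) (l : Combinatorics.Line κ ι)
    (a : ℕ+) (b : Pf ℕ+) :
    ∃ (a' : ℕ+) (b' : Pf ℕ+), ∀ k,
      a' + pfSum b' (v k) = a + pfSum b (interleave e fun i => v (l k i)) := by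
  classical
  let fixed (t : ℕ+) (i : ι) : ℕ := (l.idxFun i).elim 0 fun k => v k (e (t, i))
  let active : Finset ι := {i | l.idxFun i = none}
  have hactive : active.Nonempty := l.proper.imp fun i hi => by simpa [active] using hi
  obtain ⟨a', ha'⟩ : ∃ a' : ℕ+, (a' : ℕ) = a + ∑ t ∈ b.1, ∑ i, fixed t i :=
    ⟨⟨_, by positivity⟩, rfl⟩
  refine ⟨a', ⟨(b.1 ×ˢ active).image e, (b.2.product hactive).image e⟩,
    fun k => PNat.coe_injective ?_⟩
  have hsplit (t : ℕ+) : ∑ i, (v (l k i) (e (t, i)) : ℕ) =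
      ∑ i, fixed t i + ∑ i ∈ active, (v k (e (t, i)) : ℕ) := by
    rw [Finset.sum_filter, ← Finset.sum_add_distrib]
    refine Finset.sum_congr rfl fun i _ => ?_
    cases h : l.idxFun i <;> simp [fixed, h]
  simp only [PNat.add_coe, ha', coe_pfSum, interleave, hsplit, Finset.sum_add_distrib,
    Finset.sum_image he.injOn, Finset.sum_product, add_assoc]

theorem IsJSet.exists_monochromatic {A : Set ℕ+} (hA : IsJSet A) {κ : Type*} [Finite κ]
    (C : ℕ+ → κ) (F : Pf (ℕ+ → ℕ+)) :
    ∃ (a : ℕ+) (b : Pf ℕ+) (c : κ), ∀ f ∈ F.1, a + pfSum b f ∈ A ∧ C (a + pfSum b f) = c := by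
  classical
  obtain ⟨ι, _, hι⟩ := Combinatorics.Line.exists_mono_in_high_dimension F.1 κ
  have : Nonempty ι := by
    obtain ⟨l, -⟩ := hι fun _ => C 1
    exact ⟨l.proper.choose⟩
  have : Nonempty F.1 := F.2.to_subtype
  obtain ⟨e, he⟩ := exists_injective_nat (ℕ+ × ι)
  replace he : Injective fun q => (e q).succPNat := Nat.succPNat_injective.comp he
  let g (w : ι → F.1) : ℕ+ → ℕ+ := interleave (fun q => (e q).succPNat) fun i => (w i).1
  obtain ⟨a, b, hab⟩ := hA ⟨Finset.univ.image g, Finset.univ_nonempty.image g⟩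
  obtain ⟨l, c, hl⟩ := hι fun w => C (a + pfSum b (g w))
  obtain ⟨a', b', hab'⟩ := exists_add_pfSum_eq_interleave_line he Subtype.val l a b
  refine ⟨a', b', c, fun f hf => ?_⟩
  rw [hab' ⟨f, hf⟩]
  exact ⟨hab _ (Finset.mem_image_of_mem g (Finset.mem_univ _)), hl ⟨f, hf⟩⟩

theorem IsJSet.or_of_union {A B : Set ℕ+} (h : IsJSet (A ∪ B)) : IsJSet A ∨ IsJSet B := by
  classical
  by_contra! hAB
  simp only [IsJSet, not_forall, not_exists] at hAB
  obtain ⟨⟨F₁, h₁⟩, ⟨F₂, h₂⟩⟩ := hAB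
  obtain ⟨a, b, c, hc⟩ := h.exists_monochromatic (· ∈ A)
    ⟨F₁.1 ∪ F₂.1, F₁.2.mono Finset.subset_union_left⟩
  obtain ⟨f₁, hf₁, hfA⟩ := h₁ a b
  obtain ⟨f₂, hf₂, hfB⟩ := h₂ a b
  have h₁' := hc f₁ (Finset.mem_union_left _ hf₁)
  have h₂' := hc f₂ (Finset.mem_union_right _ hf₂)
  exact h₂'.1.elim (fun h => hfA (by rwa [h₁'.2, ← h₂'.2])) hfB

end JSets

section IdempotentsInJ

theorem exists_ultrafilter_forall_mem {X : Type*} {P : Set X → Prop} (hempty : ¬ P ∅)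
    (hmono : ∀ s t, s ⊆ t → P s → P t) (hunion : ∀ s t, P (s ∪ t) → P s ∨ P t) {A : Set X}
    (hA : P A) : ∃ p : Ultrafilter X, A ∈ p ∧ ∀ B ∈ p, P B := by
  let l : Filter X := comk (fun s => ¬ P (A ∩ s)) (by simpa using hempty)
    (fun t ht s hst h => ht (hmono _ _ (Set.inter_subset_inter_right A hst) h))
    (fun s hs t ht h => (hunion _ _ (by rwa [← Set.inter_union_distrib_left])).elim hs ht)
  have : l.NeBot := ⟨fun h => (empty_mem_iff_bot.2 h) (by simpa using hA)⟩
  refine ⟨Ultrafilter.of l, Ultrafilter.of_le l ?_, fun B hB => ?_⟩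
  · simpa [l] using hempty
  · by_contra hPB
    have hBc : Bᶜ ∈ l := by
      simpa [l] using fun h => hPB (hmono _ _ Set.inter_subset_right h)
    exact Ultrafilter.compl_notMem_iff.2 hB (Ultrafilter.of_le l hBc)

theorem IsJSet.exists_mem_J {A : Set ℕ+} (hA : IsJSet A) : ∃ p ∈ J, A ∈ p := by
  obtain ⟨p, hAp, hp⟩ := exists_ultrafilter_forall_mem not_isJSet_empty
    (fun _ _ h hs => hs.mono h) (fun _ _ => IsJSet.or_of_union) hA
  exact ⟨p, hp, hAp⟩

theorem isClosed_J : IsClosed J := by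
  have hJ : J = ⋂ A ∈ {A : Set ℕ+ | ¬ IsJSet A}, {p : Ultrafilter ℕ+ | Aᶜ ∈ p} := by
    ext p
    simp only [J, Set.mem_iInter, Set.mem_ofPred_eq, Ultrafilter.compl_mem_iff_notMem]
    exact forall_congr' fun A => not_imp_not.symm
  rw [hJ]
  exact isClosed_biInter fun A _ => ultrafilter_isClosed_basic _

theorem add_mem_J {p : Ultrafilter ℕ+} (hp : p ∈ J) (q : Ultrafilter ℕ+) : p + q ∈ J := by
  intro A hA F
  obtain ⟨a, b, hab⟩ := hp _ hA F
  have hq : ∀ᶠ y in (q : Filter ℕ+), ∀ f ∈ F.1, a + pfSum b f + y ∈ A :=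
    (Finset.eventually_all F.1).2 hab
  obtain ⟨y, hy⟩ := hq.exists
  exact ⟨a + y, b, fun f hf => by simpa only [add_right_comm] using hy f hf⟩

theorem exists_idempotent_mem_J {ι : Type*} [Preorder ι] [Nonempty ι] [IsDirectedOrder ι]
    {C : ι → Set ℕ+} (hanti : Antitone C) (hC : ∀ i, IsJSet (C i))
    (hadd : ∀ i, ∀ x ∈ C i, ∃ j, ∀ y ∈ C j, x + y ∈ C i) :
    ∃ p ∈ J, p + p = p ∧ ∀ i, C i ∈ p := by
  let K (i : ι) : Set (Ultrafilter ℕ+) := J ∩ {p | C i ∈ p}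
  have hK (i : ι) : IsClosed (K i) := isClosed_J.inter (ultrafilter_isClosed_basic _)
  have hKanti : Antitone K := fun _ _ hij p hp => ⟨hp.1, mem_of_superset hp.2 (hanti hij)⟩
  have hne : (⋂ i, K i).Nonempty :=
    IsCompact.nonempty_iInter_of_directed_nonempty_isCompact_isClosed K hKanti.directed_ge
      (fun i => (hC i).exists_mem_J) (fun i => (hK i).isCompact) hK
  have hKadd : ∀ p ∈ ⋂ i, K i, ∀ q ∈ ⋂ i, K i, p + q ∈ ⋂ i, K i := by
    simp only [Set.mem_iInter]
    refine fun p hp q hq i => ⟨add_mem_J (hp i).1 q, mem_of_superset (hp i).2 fun x hx => ?_⟩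
    obtain ⟨j, hj⟩ := hadd i x hx
    exact mem_of_superset (hq j).2 hj
  let := Ultrafilter.addSemigroup (M := ℕ+)
  obtain ⟨p, hp, hpp⟩ := exists_idempotent_in_compact_add_subsemigroup
    (Ultrafilter.continuous_add_left (M := ℕ+)) _ hne (isClosed_iInter hK).isCompact hKadd
  rw [Set.mem_iInter] at hp
  exact ⟨p, (hp (Classical.arbitrary ι)).1, hpp, fun i => (hp i).2⟩

end IdempotentsInJ

section ChainSums

variable {κ S : Type*} [Preorder κ]

/-- `IsChainSum T i k x` says that `x` is a sum `T i₁ + ⋯ + T iₙ` along a chain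
`i = i₁ < ⋯ < iₙ = k`. -/
inductive IsChainSum [Add S] (T : κ → S) (i : κ) : κ → S → Prop
  | single : IsChainSum T i i (T i)
  | snoc {j k : κ} {x : S} : IsChainSum T i j x → j < k → IsChainSum T i k (x + T k)

theorem IsChainSum.le [Add S] {T : κ → S} {i k : κ} {x : S} (h : IsChainSum T i k x) : i ≤ k := by
  induction h with
  | single => exact le_rfl
  | snoc _ hjk ih => exact ih.trans hjk.le

theorem IsChainSum.trans [AddSemigroup S] {T : κ → S} {i j i' k : κ} {x y : S}
    (hx : IsChainSum T i j x) (hj : j < i') (hy : IsChainSum T i' k y) :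
    IsChainSum T i k (x + y) := by
  induction hy with
  | single => exact hx.snoc hj
  | snoc _ hlt ih => exact add_assoc x _ _ ▸ ih.snoc hlt

theorem wellFoundedLT_of_finite_Iio (hκ : ∀ k : κ, (Set.Iio k).Finite) : WellFoundedLT κ :=
  ⟨Subrelation.wf (fun h => Set.ncard_lt_ncard (Set.Iio_ssubset_Iio h) (hκ _))
    (measure fun k : κ => (Set.Iio k).ncard).wf⟩

theorem finite_isChainSum [Add S] (hκ : ∀ k : κ, (Set.Iio k).Finite) (T : κ → S) (k : κ) :
    {q : κ × S | IsChainSum T q.1 k q.2}.Finite := by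
  have := wellFoundedLT_of_finite_Iio hκ
  induction k using WellFoundedLT.induction with
  | _ k ih =>
    refine ((Set.finite_singleton (k, T k)).union ((hκ k).biUnion fun j hj =>
      (ih j hj).image fun q => (q.1, q.2 + T k))).subset ?_
    rintro ⟨i, x⟩ (hx : IsChainSum T i k x)
    cases hx with
    | single => exact Or.inl rfl
    | @snoc j _ y hy hjk => exact Or.inr (Set.mem_biUnion hjk ⟨(i, y), hy, rfl⟩)

/-- The sums of `T j` along a strictly increasing chain whose first index lies above `i`. -/
def chainSumsAbove [Add S] (T : κ → S) (i : κ) : Set S :=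
  {x | ∃ j k, i < j ∧ IsChainSum T j k x}

theorem antitone_chainSumsAbove [Add S] (T : κ → S) : Antitone (chainSumsAbove T) :=
  fun _ _ hii' _ ⟨j, k, hj, hx⟩ => ⟨j, k, hii'.trans_lt hj, hx⟩

theorem exists_forall_add_mem_chainSumsAbove [AddSemigroup S] {T : κ → S} {i : κ} {x : S}
    (hx : x ∈ chainSumsAbove T i) :
    ∃ j, ∀ y ∈ chainSumsAbove T j, x + y ∈ chainSumsAbove T i := by
  obtain ⟨j, k, hij, hx⟩ := hx
  exact ⟨k, fun y ⟨i', k', hk, hy⟩ => ⟨j, k', hij, hx.trans hk hy⟩⟩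

/-- The tuples `(x₁, …, xₘ)` in which `x_j` is a sum of `T j` along a chain, the `m` chains being
consecutive segments of one chain whose last index lies in `I`. -/
def blockSums [Add S] : {m : ℕ} → (Fin m → κ → S) → Set κ → Set (Fin m → S)
  | 0, _, _ => Set.univ
  | _ + 1, T, I => {x | ∃ i, ∃ k ∈ I, IsChainSum (T (Fin.last _)) i k (x (Fin.last _)) ∧
      Fin.init x ∈ blockSums (Fin.init T) (Set.Iio i)}

theorem snoc_mem_blockSums [Add S] {m : ℕ} {T : Fin (m + 1) → κ → S} {I : Set κ} {x : Fin m → S}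
    {y : S} : (Fin.snoc x y : Fin (m + 1) → S) ∈ blockSums T I ↔
      ∃ i, ∃ k ∈ I, IsChainSum (T (Fin.last m)) i k y ∧
        x ∈ blockSums (Fin.init T) (Set.Iio i) := by
  simp only [blockSums, Set.mem_ofPred_eq, Fin.snoc_last, Fin.init_snoc]

theorem blockSums_mono [Add S] {m : ℕ} (T : Fin m → κ → S) : Monotone (blockSums T) := by
  intro I I' h x hx
  cases m with
  | zero => trivial
  | succ m =>
    obtain ⟨i, k, hk, hx⟩ := hx
    exact ⟨i, k, h hk, hx⟩

theorem finite_blockSums [Add S] (hκ : ∀ k : κ, (Set.Iio k).Finite) {m : ℕ}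
    (T : Fin m → κ → S) {I : Set κ} (hI : I.Finite) : (blockSums T I).Finite := by
  induction m generalizing I with
  | zero => exact Set.toFinite _
  | succ m ih =>
    refine (hI.biUnion fun k _ => (finite_isChainSum hκ (T (Fin.last m)) k).biUnion fun q _ =>
      (ih (Fin.init T) (hκ q.1)).image fun x => (Fin.snoc x q.2 : Fin (m + 1) → S)).subset ?_
    rintro x ⟨i, k, hk, hlast, hinit⟩
    exact Set.mem_biUnion hk (Set.mem_biUnion (show (i, _) ∈ _ from hlast)
      ⟨_, hinit, Fin.snoc_init_self x⟩)

theorem blockSums_mem_tensor [Nonempty κ] [Add S] {m : ℕ} {T : Fin m → κ → S}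
    {p : Fin m → Ultrafilter S} (hp : ∀ j i, chainSumsAbove (T j) i ∈ p j) :
    {x | ∃ i, x ∈ blockSums T (Set.Iic i)} ∈ tensor m p := by
  induction m with
  | zero => exact univ_mem' fun _ => ⟨Classical.arbitrary κ, trivial⟩
  | succ m ih =>
    rw [mem_tensor_succ]
    filter_upwards [ih (p := Fin.init p) (T := Fin.init T) fun j => hp j.castSucc]
    rintro x ⟨i, hx⟩
    filter_upwards [hp (Fin.last m) i]
    rintro y ⟨j, k, hij, hy⟩
    exact ⟨k, snoc_mem_blockSums.2
      ⟨j, k, le_rfl, hy, blockSums_mono _ (fun _ hl => lt_of_le_of_lt hl hij) hx⟩⟩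

end ChainSums

section Enumerations

theorem rel_append_of_lt {X : Type*} {r : X → X → Prop} {m n : ℕ} {f : Fin m → X} {g : Fin n → X}
    (hf : ∀ i j, i < j → r (f i) (f j)) (hg : ∀ i j, i < j → r (g i) (g j))
    (hfg : ∀ i j, r (f i) (g j)) (i j : Fin (m + n)) (hij : i < j) :
    r (Fin.append f g i) (Fin.append f g j) := by
  induction i using Fin.addCases with
  | left i =>
    induction j using Fin.addCases with
    | left j => simpa only [Fin.append_left] using hf i j hij
    | right j => simpa only [Fin.append_left, Fin.append_right] using hfg i j
  | right i =>
    induction j using Fin.addCases with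
    | left j => exact (Nat.not_lt.2 (j.2.le.trans (Nat.le_add_right m i)) hij).elim
    | right j => simpa only [Fin.append_right] using hg i j (Fin.natAdd_lt_natAdd_iff _ |>.1 hij)

variable {κ : Type*} [Preorder κ]

theorem IsChainSum.exists_strictMono {T : κ → ℕ+} {i k : κ} {x : ℕ+} (h : IsChainSum T i k x) :
    ∃ (n : ℕ) (G : Fin n → κ), StrictMono G ∧ (∀ a, i ≤ G a ∧ G a ≤ k) ∧
      (x : ℕ) = ∑ a, (T (G a) : ℕ) := by
  induction h with
  | single => exact ⟨1, fun _ => i, Subsingleton.strictMono _, fun _ => ⟨le_rfl, le_rfl⟩, by simp⟩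
  | @snoc j k x hj hjk ih =>
    obtain ⟨n, G, hG, hGik, hx⟩ := ih
    refine ⟨n + 1, Fin.append G fun _ : Fin 1 => k,
      rel_append_of_lt hG (Subsingleton.strictMono _) fun a _ => (hGik a).2.trans_lt hjk, ?_, ?_⟩
    · refine Fin.addCases (fun a => ?_) fun _ => ?_
      · simpa using ⟨(hGik a).1, (hGik a).2.trans hjk.le⟩
      · simpa using hj.le.trans hjk.le
    · rw [PNat.add_coe, hx, Fin.sum_univ_add]
      simp

theorem exists_labelling_of_mem_blockSums {m : ℕ} {T : Fin m → κ → ℕ+} {I : Set κ}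
    (hI : IsLowerSet I) {x : Fin m → ℕ+} (hx : x ∈ blockSums T I) :
    ∃ (n : ℕ) (G : Fin n → κ) (c : Fin n → Fin m), StrictMono G ∧ Monotone c ∧ (∀ a, G a ∈ I) ∧
      ∀ j, (x j : ℕ) = ∑ a with c a = j, (T j (G a) : ℕ) := by
  induction m generalizing I with
  | zero => exact ⟨0, Fin.elim0, Fin.elim0, fun a => a.elim0, fun a => a.elim0, fun a => a.elim0,
      fun j => j.elim0⟩
  | succ m ih =>
    obtain ⟨i, k, hk, hlast, hinit⟩ := hx
    obtain ⟨n₁, G₁, c₁, hG₁, hc₁, hlt, hsum₁⟩ := ih (isLowerSet_Iio i) hinit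
    obtain ⟨n₂, G₂, hG₂, hik, hsum₂⟩ := hlast.exists_strictMono
    refine ⟨n₁ + n₂, Fin.append G₁ G₂, Fin.append (Fin.castSucc ∘ c₁) fun _ => Fin.last m,
      rel_append_of_lt hG₁ hG₂ fun a b => (hlt a).trans_le (hik b).1,
      monotone_iff_forall_lt.2 (rel_append_of_lt (fun a b hab => hc₁ hab.le)
        (fun _ _ _ => le_rfl) fun a _ => Fin.le_last _), ?_, fun j => ?_⟩
    · refine Fin.addCases (fun a => ?_) fun b => ?_
      · simpa using hI ((hlt a).le.trans hlast.le) hk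
      · simpa using hI (hik b).2 hk
    · rw [Finset.sum_filter, Fin.sum_univ_add]
      rcases j.eq_castSucc_or_eq_last with ⟨j, rfl⟩ | rfl
      · simpa [Fin.append_left, Fin.append_right, ← Finset.sum_filter,
          (Fin.castSucc_lt_last j).ne', Fin.init] using hsum₁ j
      · simpa [Fin.append_left, Fin.append_right, (Fin.castSucc_lt_last _).ne] using hsum₂

theorem exists_strictMono_of_mem_blockSums {m : ℕ} {T : Fin m → κ → ℕ+} {I : Set κ}
    {x : Fin m → ℕ+} (hx : x ∈ blockSums T I) :
    ∃ n, m ≤ n ∧ ∃ (G : Fin n → κ) (β : Fin m → Pf (Fin n)), StrictMono G ∧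
      (∀ j j', j < j' → Before (β j) (β j')) ∧ (fun j => pfSum (β j) (T j ∘ G)) = x := by
  obtain ⟨n, G, c, hG, hc, -, hsum⟩ :=
    exists_labelling_of_mem_blockSums isLowerSet_univ (blockSums_mono T (Set.subset_univ I) hx)
  have hne (j : Fin m) : ({a | c a = j} : Finset (Fin n)).Nonempty :=
    Finset.nonempty_of_sum_ne_zero (hsum j ▸ (x j).ne_zero)
  have hsurj : Surjective c := fun j => by simpa [Finset.Nonempty] using hne j
  refine ⟨n, by simpa using Fintype.card_le_of_surjective c hsurj, G, fun j => ⟨_, hne j⟩, hG,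
    fun j j' hjj' => ?_, funext fun j => PNat.coe_injective (hsum j).symm⟩
  simp only [Before, Finset.max'_lt_iff, Finset.lt_min'_iff, Finset.mem_filter_univ]
  rintro b rfl a rfl
  exact hc.reflect_lt hjj'

theorem isChainSum_pfSum {ι : Type*} [LinearOrder ι] {T : κ → ℕ+} {G : ι → κ} (hG : StrictMono G)
    (s : Pf ι) : IsChainSum T (G (s.1.min' s.2)) (G (s.1.max' s.2)) (pfSum s (T ∘ G)) := by
  obtain ⟨s, hs⟩ := s
  induction s using Finset.induction_on_max with
  | empty => exact absurd hs Finset.not_nonempty_empty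
  | insert a s ha ih =>
    rcases s.eq_empty_or_nonempty with rfl | hs'
    · have hsum : pfSum ⟨{a}, Finset.singleton_nonempty a⟩ (T ∘ G) = T (G a) :=
        PNat.coe_injective (by simp [coe_pfSum])
      simpa [hsum] using IsChainSum.single (T := T) (i := G a)
    · have hmin : (insert a s).min' hs = s.min' hs' := by
        rw [Finset.min'_insert a s hs', min_eq_right (ha _ (s.min'_mem hs')).le]
      have hmax : (insert a s).max' hs = a := by
        rw [Finset.max'_insert a s hs', max_eq_left (ha _ (s.max'_mem hs')).le]
      have hsum : pfSum ⟨insert a s, hs⟩ (T ∘ G) = pfSum ⟨s, hs'⟩ (T ∘ G) + T (G a) :=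
        PNat.coe_injective <| by
          simp [coe_pfSum, Finset.sum_insert fun h => (ha a h).false, add_comm]
      rw [hmin, hmax, hsum]
      exact (ih hs').snoc (hG (ha _ (s.max'_mem hs')))

theorem mem_blockSums_of_strictMono {ι : Type*} [LinearOrder ι] {m : ℕ} (T : Fin m → κ → ℕ+)
    {G : ι → κ} (hG : StrictMono G) {β : Fin m → Pf ι} (hβ : ∀ j j', j < j' → Before (β j) (β j')) :
    (fun j => pfSum (β j) (T j ∘ G)) ∈ blockSums T Set.univ := by
  suffices h : ∀ I, (∀ j, G ((β j).1.max' (β j).2) ∈ I) →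
      (fun j => pfSum (β j) (T j ∘ G)) ∈ blockSums T I from h _ fun _ => trivial
  induction m with
  | zero => exact fun _ _ => trivial
  | succ m ih =>
    exact fun I hI => ⟨_, _, hI (Fin.last m), isChainSum_pfSum hG (β (Fin.last m)),
      ih (Fin.init T) (fun j j' h => hβ _ _ h) _ fun j => hG (hβ _ _ (Fin.castSucc_lt_last j))⟩

end Enumerations

section PointedPf

/-- A pair `(G, f)` with `G ∈ 𝒫_f(X)` and `f ∈ G`. Chains `G₁ ⊊ ⋯ ⊊ Gₙ` with selections `fᵢ ∈ Gᵢ`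
are strictly increasing sequences of such pairs for the preorder below, which ignores `f`. -/
structure PointedPf (X : Type*) where
  carrier : Pf X
  point : X
  point_mem : point ∈ carrier.1

instance {X : Type*} : Preorder (PointedPf X) := Preorder.lift PointedPf.carrier

variable {X : Type*}

instance [Nonempty X] : Nonempty (PointedPf X) :=
  ⟨⟨⟨{Classical.arbitrary X}, Finset.singleton_nonempty _⟩, _, Finset.mem_singleton_self _⟩⟩

instance : IsDirectedOrder (PointedPf X) where
  directed p q := by
    classical
    exact ⟨⟨⟨p.carrier.1 ∪ q.carrier.1, p.carrier.2.mono Finset.subset_union_left⟩, p.point,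
      Finset.mem_union_left _ p.point_mem⟩, Finset.subset_union_left, Finset.subset_union_right⟩

theorem Pf.finite_Iio (F : Pf X) : (Set.Iio F).Finite :=
  (F.1.powerset.finite_toSet.preimage Subtype.val_injective.injOn).subset
    fun _ h => Finset.mem_coe.2 (Finset.mem_powerset.2 h.le)

theorem PointedPf.finite_carrier_lt (F : Pf X) : {q : PointedPf X | q.carrier < F}.Finite := by
  have hinj : Injective fun q : PointedPf X => (q.carrier, q.point) := by
    rintro ⟨_, _, _⟩ ⟨_, _, _⟩ h
    simpa using h
  refine (((Pf.finite_Iio F).prod F.1.finite_toSet).preimage hinj.injOn).subset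
    fun q (hq : q.carrier < F) => ⟨hq, ?_⟩
  exact Finset.coe_subset.2 hq.le q.point_mem

theorem PointedPf.finite_Iio (q : PointedPf X) : (Set.Iio q).Finite :=
  finite_carrier_lt q.carrier

theorem PointedPf.exists_carrier_lt [Infinite X] (q : PointedPf X) (F : Pf X) :
    ∃ G : Pf X, q.carrier < G ∧ F ≤ G := by
  classical
  obtain ⟨x, hx⟩ := Infinite.exists_notMem_finset (q.carrier.1 ∪ F.1)
  refine ⟨⟨insert x (q.carrier.1 ∪ F.1), Finset.insert_nonempty _ _⟩, ?_, ?_⟩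
  · exact Finset.subset_union_left.trans_ssubset (Finset.ssubset_insert hx)
  · exact Finset.subset_union_right.trans (Finset.subset_insert _ _)

end PointedPf

section Terms

/-- The summand `α(G) + ∑ t ∈ H(G), f(t)` attached to a pair `(G, f)`. -/
def term (α : Pf (ℕ+ → ℕ+) → ℕ+) (H : Pf (ℕ+ → ℕ+) → Pf ℕ+) (q : PointedPf (ℕ+ → ℕ+)) : ℕ+ :=
  α q.carrier + pfSum (H q.carrier) q.point

theorem isJSet_chainSumsAbove_term (α : Pf (ℕ+ → ℕ+) → ℕ+) (H : Pf (ℕ+ → ℕ+) → Pf ℕ+)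
    (q : PointedPf (ℕ+ → ℕ+)) :
    IsJSet (chainSumsAbove (term α H) q) := fun F => by
  obtain ⟨G, hqG, hFG⟩ := q.exists_carrier_lt F
  exact ⟨α G, H G, fun f hf => ⟨⟨G, f, hFG hf⟩, _, hqG, .single⟩⟩

theorem exists_idempotent_chainSumsAbove_term_mem (α : Pf (ℕ+ → ℕ+) → ℕ+)
    (H : Pf (ℕ+ → ℕ+) → Pf ℕ+) :
    ∃ p ∈ J, p + p = p ∧ ∀ q, chainSumsAbove (term α H) q ∈ p :=
  exists_idempotent_mem_J (antitone_chainSumsAbove _) (isJSet_chainSumsAbove_term α H)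
    fun _ _ => exists_forall_add_mem_chainSumsAbove

end Terms

section Selection

theorem exists_forall_of_finite_Iio {ι V : Type*} [Preorder ι]
    (hι : ∀ i : ι, (Set.Iio i).Finite) {P : ι → Set V → V → Prop}
    (h : ∀ i s, s.Finite → ∃ v, P i s v) : ∃ c : ι → V, ∀ i, P i (c '' Set.Iio i) (c i) := by
  have := wellFoundedLT_of_finite_Iio hι
  choose v hv using h
  have hfin (i : ι) (w : Set.Iio i → V) : (Set.range w).Finite :=
    have := (hι i).to_subtype
    Set.finite_range w
  let c : ι → V := WellFoundedLT.fix fun i w => v i _ (hfin i fun j => w j.1 j.2)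
  have hc (i : ι) : c i = v i _ (hfin i fun j => c j) := WellFoundedLT.fix_eq _ i
  refine ⟨c, fun i => ?_⟩
  rw [hc i, Set.image_eq_range]
  exact hv _ _ _

/-- Both `x` and its translates `x + z` by the elements of `R` lie in `D`. -/
def StaysIn {S : Type*} [Add S] (D R : Set S) (x : S) : Prop :=
  x ∈ D ∧ ∀ z ∈ R, x + z ∈ D

theorem StaysIn.add {S : Type*} [AddSemigroup S] {D R R' : Set S} {x y : S} (hx : StaysIn D R x)
    (hy : StaysIn R R' y) : StaysIn D R' (x + y) :=
  ⟨hx.2 y hy.1, fun z hz => add_assoc x y z ▸ hx.2 _ (hy.2 z hz)⟩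

theorem StaysIn.mono {S : Type*} [Add S] {D D' R : Set S} {x : S} (hx : StaysIn D R x)
    (h : D ⊆ D') : StaysIn D' R x :=
  ⟨h hx.1, fun z hz => h (hx.2 z hz)⟩

theorem exists_forall_staysIn {p : Ultrafilter ℕ+} (hp : p ∈ J) (hpp : p + p = p) {D : Set ℕ+}
    (hD : D ∈ p) (r : ℕ+) (F : Pf (ℕ+ → ℕ+)) :
    ∃ (a : ℕ+) (b : Pf ℕ+), (∀ t ∈ b.1, r < t) ∧
      ∃ R ∈ p, ∀ f ∈ F.1, StaysIn D R (a + pfSum b f) := by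
  have hD' : {x | {y | x + y ∈ D} ∈ p} ∈ p := (mem_ultrafilter_add p p D).1 (hpp.symm ▸ hD)
  obtain ⟨a, b, hb, hab⟩ := (hp _ (inter_mem hD hD')).exists_forall_lt r F
  exact ⟨a, b, hb, {z | ∀ f ∈ F.1, a + pfSum b f + z ∈ D},
    (Finset.eventually_all F.1).2 fun f hf => (hab f hf).2,
    fun f hf => ⟨(hab f hf).1, fun z hz => hz f hf⟩⟩

theorem exists_forall_before {ι : Type*} [LinearOrder ι] [Nonempty ι] {s : Set (Pf ι)}
    (hs : s.Finite) : ∃ r : ι, ∀ b : Pf ι, (∀ t ∈ b.1, r < t) → ∀ w ∈ s, Before w b := by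
  obtain ⟨r, hr⟩ := (hs.image fun w : Pf ι => w.1.max' w.2).bddAbove
  exact ⟨r, fun b hb w hw => (hr (Set.mem_image_of_mem _ hw)).trans_lt (hb _ (b.1.min'_mem b.2))⟩

theorem exists_forall_staysIn_of_lt {p : Ultrafilter ℕ+} (hp : p ∈ J) (hpp : p + p = p)
    {B : Pf (ℕ+ → ℕ+) → Set ℕ+} (hB : ∀ F, B F ∈ p) :
    ∃ (α : Pf (ℕ+ → ℕ+) → ℕ+) (H : Pf (ℕ+ → ℕ+) → Pf ℕ+) (R : Pf (ℕ+ → ℕ+) → Set ℕ+),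
      (∀ F G, F < G → Before (H F) (H G)) ∧
      (∀ q, StaysIn (B q.carrier) (R q.carrier) (term α H q)) ∧
      ∀ q q', q < q' → StaysIn (R q.carrier) (R q'.carrier) (term α H q') := by
  obtain ⟨c, hc⟩ := exists_forall_of_finite_Iio Pf.finite_Iio
    (V := ℕ+ × Pf ℕ+ × {R : Set ℕ+ // R ∈ p})
    (P := fun F s v => (∀ w ∈ s, Before w.2.1 v.2.1) ∧ ∀ f ∈ F.1,
      StaysIn (B F ∩ ⋂ w ∈ s, w.2.2.1) v.2.2.1 (v.1 + pfSum v.2.1 f)) fun F s hs => by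
    obtain ⟨r, hr⟩ := exists_forall_before (hs.image fun w => w.2.1)
    obtain ⟨a, b, hb, R, hR, hab⟩ := exists_forall_staysIn hp hpp
      (inter_mem (hB F) ((biInter_mem hs).2 fun w _ => w.2.2.2)) r F
    exact ⟨⟨a, b, R, hR⟩, fun w hw => hr b hb _ (Set.mem_image_of_mem _ hw), hab⟩
  refine ⟨fun F => (c F).1, fun F => (c F).2.1, fun F => (c F).2.2.1,
    fun F G h => (hc G).1 _ (Set.mem_image_of_mem c h),
    fun q => ((hc _).2 _ q.point_mem).mono Set.inter_subset_left,
    fun q q' h => ((hc _).2 _ q'.point_mem).mono ?_⟩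
  exact Set.inter_subset_right.trans (Set.biInter_subset_of_mem (Set.mem_image_of_mem c h))

theorem exists_forall_isChainSum_mem {p : Ultrafilter ℕ+} (hp : p ∈ J) (hpp : p + p = p)
    {B : Pf (ℕ+ → ℕ+) → Set ℕ+} (hB : ∀ F, B F ∈ p) :
    ∃ (α : Pf (ℕ+ → ℕ+) → ℕ+) (H : Pf (ℕ+ → ℕ+) → Pf ℕ+),
      (∀ F G, F < G → Before (H F) (H G)) ∧
      ∀ i k x, IsChainSum (term α H) i k x → x ∈ B i.carrier := by
  obtain ⟨α, H, R, hH, hfirst, hnext⟩ := exists_forall_staysIn_of_lt hp hpp hB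
  have hstay {i k x} (hx : IsChainSum (term α H) i k x) :
      StaysIn (B i.carrier) (R k.carrier) x := by
    induction hx with
    | single => exact hfirst i
    | snoc _ hjk ih => exact ih.add (hnext _ _ hjk)
  exact ⟨α, H, hH, fun i k x hx => (hstay hx).1⟩

theorem exists_blockSums_subset {m : ℕ} {p : Fin m → Ultrafilter ℕ+}
    (hp : ∀ j, p j ∈ J ∧ p j + p j = p j) {A : Set (Fin m → ℕ+)} (hA : A ∈ tensor m p) :
    ∃ (α : Fin m → Pf (ℕ+ → ℕ+) → ℕ+) (H : Fin m → Pf (ℕ+ → ℕ+) → Pf ℕ+),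
      (∀ j F G, F < G → Before (H j F) (H j G)) ∧
      blockSums (fun j => term (α j) (H j)) Set.univ ⊆ A := by
  induction m with
  | zero => exact ⟨fun j => j.elim0, fun j => j.elim0, fun j => j.elim0, fun x _ => by
      convert Ultrafilter.mem_pure.1 hA⟩
  | succ m ih =>
    obtain ⟨α, H, hH, hsub⟩ := ih (p := Fin.init p) (fun j => hp j.castSucc)
      ((mem_tensor_succ m p A).1 hA)
    let T (j : Fin m) := term (α j) (H j)
    let B (F : Pf (ℕ+ → ℕ+)) : Set ℕ+ :=
      {y | ∀ x ∈ blockSums T {q | q.carrier < F}, (Fin.snoc x y : Fin (m + 1) → ℕ+) ∈ A}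
    have hfin (F : Pf (ℕ+ → ℕ+)) : (blockSums T {q | q.carrier < F}).Finite :=
      finite_blockSums PointedPf.finite_Iio T (PointedPf.finite_carrier_lt F)
    have hB (F : Pf (ℕ+ → ℕ+)) : B F ∈ p (Fin.last m) :=
      (eventually_all_finite (hfin F)).2 fun x hx => hsub (blockSums_mono T (Set.subset_univ _) hx)
    obtain ⟨a, h, hh, hmem⟩ :=
      exists_forall_isChainSum_mem (hp (Fin.last m)).1 (hp (Fin.last m)).2 hB
    have hT : (Fin.init fun j => term (Fin.snoc (α := fun _ => _) α a j)
        (Fin.snoc (α := fun _ => _) H h j)) = T :=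
      funext fun j => by simp only [Fin.init, Fin.snoc_castSucc, T]
    refine ⟨Fin.snoc α a, Fin.snoc H h, fun j => ?_, ?_⟩
    · rcases j.eq_castSucc_or_eq_last with ⟨j, rfl⟩ | rfl
      · simpa only [Fin.snoc_castSucc] using hH j
      · simpa only [Fin.snoc_last] using hh
    · rintro x ⟨i, k, -, hlast, hinit⟩
      rw [← Fin.snoc_init_self x]
      refine hmem i k _ ?_ _ ?_
      · simpa only [Fin.snoc_last] using hlast
      · exact hT ▸ hinit

end Selection

end CentralSets

theorem theorem1p18 (m : ℕ) (hm : 1 ≤ m) (A : Set (Fin m → ℕ+)) :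
    (∃ (α : Fin m → Pf (ℕ+ → ℕ+) → ℕ+) (H : Fin m → Pf (ℕ+ → ℕ+) → Pf ℕ+),
      (∀ F G : Pf (ℕ+ → ℕ+), F.1 ⊂ G.1 → ∀ j : Fin m, Before (H j F) (H j G)) ∧
      (∀ n : ℕ, m ≤ n →
        ∀ G : Fin n → Pf (ℕ+ → ℕ+), (∀ i i' : Fin n, i < i' → (G i).1 ⊂ (G i').1) →
        ∀ β : Fin m → Pf (Fin n), (∀ j j' : Fin m, j < j' → Before (β j) (β j')) →
        ∀ f : Fin n → (ℕ+ → ℕ+), (∀ i : Fin n, f i ∈ (G i).1) →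
          (fun j : Fin m => pfSum (β j) fun i => α j (G i) + pfSum (H j (G i)) (f i)) ∈ A)) ↔
    (∃ p : Fin m → Ultrafilter ℕ+,
      (∀ j : Fin m, p j ∈ J ∧ p j + p j = p j) ∧ A ∈ tensor m p) := by
  constructor
  · rintro ⟨α, H, -, hA⟩
    choose p hpJ hpp hp using fun j => exists_idempotent_chainSumsAbove_term_mem (α j) (H j)
    refine ⟨p, fun j => ⟨hpJ j, hpp j⟩, Filter.mem_of_superset (blockSums_mem_tensor hp) ?_⟩
    rintro x ⟨i, hx⟩
    obtain ⟨n, hn, G, β, hG, hβ, rfl⟩ := exists_strictMono_of_mem_blockSums hx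
    exact hA n hn (fun a => (G a).carrier) (fun _ _ h => hG h) β hβ _ fun a => (G a).point_mem
  · rintro ⟨p, hp, hA⟩
    obtain ⟨α, H, hH, hsub⟩ := exists_blockSums_subset hp hA
    refine ⟨α, H, fun F G h j => hH j F G h, fun n _ G hG β hβ f hf => hsub ?_⟩
    let G' (i : Fin n) : PointedPf (ℕ+ → ℕ+) := ⟨G i, f i, hf i⟩
    have hG' : StrictMono G' := fun i i' h => hG i i' h
    exact mem_blockSums_of_strictMono _ hG' hβ
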